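/- Let $G$ be a finite simple graph. An odd connected pairing of size $s$ in $G$ is a set $\{(u_1,v_1),\dots,(u_s,v_s)\}$ of $s$ ordered pairs, where $u_1,v_1,\dots,u_s,v_s$ are $2s$ pairwise distinct vertices of $G$, such that for all $i\neq j$ at least one of $\{u_i,u_j\}$ and $\{v_i,v_j\}$ is an edge of $G$. (The pairs $\{u_i,v_i\}$ need not be edges.) Let $\alpha(G)$ denote the independence number of $G$. For every fixed $\varepsilon>0$ there exists $N$ such that for every integer $n\ge N$ there is an $n$-vertex graph $G$ with $\alpha(G)\le 2$ which does not contain an odd connected pairing of size $s$ for any $s\ge \varepsilon n$. -/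

import Mathlib

/-- `u 0, …, u (s-1)` and `v 0, …, v (s-1)` list the `s` ordered pairs
`(u i, v i)` of an odd connected pairing of size `s` in `G`: the `2 s` vertices are pairwise
distinct, and for all `i ≠ j` at least one of `{u i, u j}`, `{v i, v j}` is an edge of `G`. -/
structure SimpleGraph.IsOddConnectedPairing {V : Type*} (G : SimpleGraph V) {s : ℕ}
    (u v : Fin s → V) : Prop where
  distinct : Function.Injective (Sum.elim u v)
  connected : ∀ i j : Fin s, i ≠ j → G.Adj (u i) (u j) ∨ G.Adj (v i) (v j)

/-- `G` contains an odd connected pairing of size (exactly) `s`. -/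
def SimpleGraph.HasOddConnectedPairing {V : Type*} (G : SimpleGraph V) (s : ℕ) : Prop :=
  ∃ u v : Fin s → V, G.IsOddConnectedPairing u v

/-!
Taking complements, the theorem asks for a triangle-free graph `H` on `n` vertices such that any
`ε n` disjoint pairs `(u i, v i)` contain two with both `u i, u j` and `v i, v j` adjacent in `H`.
A sparse random graph is not enough: to defeat all choices of pairs by a union bound its density
would have to be so large that triangles could not be removed.

Instead `H` combines two triangle-free graphs at different scales, a graph `D` on a bounded number
`k` of colours and a graph `F` on the `n` vertices, which are coloured evenly. Two vertices are
adjacent in `H` (`SimpleGraph.colouredProduct`) if they are adjacent in `D` without a common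
neighbour in `F`, or adjacent in `F` without a common neighbour in `D`. A triangle of `H` would have
two edges of the same kind; these form a path that excludes the other kind for the third edge, and
so `D` or `F` would contain a triangle. For two pairs it now suffices that `u i, u j` are joined
through `D` and `v i, v j` through `F`. In this way the requirement of two simultaneous edges is
replaced by one edge and one non-edge of the square, once in `D` and once in `F`
(`SimpleGraph.Separates`): `v`-vertices that are adjacent and `u`-vertices without a common
neighbour. As almost all pairs of vertices of a sparse graph have no common neighbour, this is a
requirement that a union bound over all pairs can handle.

Graphs that are triangle-free and separate linearly many pairs are obtained from the random graph of
density `n ^ (-2 / 3)` by deleting the edges in triangles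
(`SimpleGraph.exists_isTriangleFree_separates`). The point is that, when the vertices `u i`, `v i`
are all distinct, common neighbours of the `u i` do not depend on the edges between the `v i`
(`SimpleGraph.card_filter_pairs_few_le`).

In a large pairing most pairs lie in heavy colour classes `(a, b)`. Because `F` separates, the heavy
classes violate the separation property of `D`, unless they are covered by few colours; and few
colours contain few vertices
(`SimpleGraph.card_le_of_isOddConnectedPairing_compl_colouredProduct`). Pairs whose two vertices
have the same colour need an extra remark: an edge of `D` between two such colours is an edge, hence
without common neighbour, on both sides, and `D` has only small independent sets.
-/

/-! ### Uniformly random labellings of a finite set -/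

section RandomLabellings
open Finset

theorem card_filter_forall_eq_zero {E : Type*} [Fintype E] [DecidableEq E] (q : ℕ) [NeZero q]
    (T : Finset E) :
    (#{g : E → Fin q | ∀ e ∈ T, g e = 0} : ℝ) = (q : ℝ) ^ Fintype.card E / (q : ℝ) ^ #T := by
  have hq : (q : ℝ) ≠ 0 := by exact_mod_cast NeZero.ne q
  have hset : ({g : E → Fin q | ∀ e ∈ T, g e = 0} : Finset _) =
      Fintype.piFinset fun e => if e ∈ T then {0} else univ := by
    ext g
    simp only [mem_filter, mem_univ, true_and, Fintype.mem_piFinset]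
    refine forall_congr' fun e => ?_
    by_cases he : e ∈ T <;> simp [he]
  have hprod : #{g : E → Fin q | ∀ e ∈ T, g e = 0} * q ^ #T = q ^ Fintype.card E := by
    rw [hset, Fintype.card_piFinset]
    have h1 : q ^ #T = ∏ e : E, if e ∈ T then q else 1 := by
      rw [prod_ite_mem, univ_inter, prod_const]
    have h2 : q ^ Fintype.card E = ∏ _e : E, q := by simp
    rw [h1, h2, ← prod_mul_distrib]
    refine prod_congr rfl fun e _ => ?_
    by_cases he : e ∈ T <;> simp [he]
  rw [eq_div_iff (pow_ne_zero _ hq)]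
  exact_mod_cast hprod

/-- Exponential lower-tail bound for the number of zeros in a random set of positions. The set `B g`
may depend on the labelling `g`, but only through its values outside `Z ⊇ B g`; so, once these are
fixed, the labels on `B g` are still uniform and independent. The probability that `B g` has at
least `b` elements but at most `T` zeros is then bounded through the mean of `2 ^ (-X)`, where `X`
is the number of zeros in `B g`. -/
theorem card_filter_few_zeros_le {E : Type*} [Fintype E] [DecidableEq E] (q : ℕ) [NeZero q]
    (B : (E → Fin q) → Finset E) (Z : Finset E) (hBZ : ∀ g, B g ⊆ Z)
    (hB : ∀ g g' : E → Fin q, (∀ e ∉ Z, g e = g' e) → B g = B g') (b T : ℕ) :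
    (#{g : E → Fin q | b ≤ #(B g) ∧ #{e ∈ B g | g e = 0} ≤ T} : ℝ) ≤
      (q : ℝ) ^ Fintype.card E * (2 ^ T * (1 - 1 / (2 * q)) ^ b) := by
  classical
  have hq1 : (1 : ℝ) ≤ q := by exact_mod_cast NeZero.one_le
  have hq : (0 : ℝ) < q := by linarith
  set c : ℝ := 1 - 1 / (2 * q) with hc
  have hc0 : 0 ≤ c := by
    have : 1 / (2 * (q : ℝ)) ≤ 1 := by
      rw [div_le_one (by positivity)]; linarith
    linarith
  have hc1 : c ≤ 1 := by
    have : 0 ≤ 1 / (2 * (q : ℝ)) := by positivity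
    linarith
  let W : (E → Fin q) → ℝ := fun g => if b ≤ #(B g) then (1 / 2) ^ #{e ∈ B g | g e = 0} else 0
  have hW0 : ∀ g, 0 ≤ W g := fun g => by
    simp only [W]; split_ifs <;> positivity
  have hlow : (#{g : E → Fin q | b ≤ #(B g) ∧ #{e ∈ B g | g e = 0} ≤ T} : ℝ) ≤
      2 ^ T * ∑ g, W g := by
    rw [card_filter, Nat.cast_sum, mul_sum]
    refine sum_le_sum fun g _ => ?_
    split_ifs with h
    · have h3 : ((1 : ℝ) / 2) ^ T ≤ W g := by
        simp only [W, h.1, if_true]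
        exact pow_le_pow_of_le_one (by norm_num) (by norm_num) h.2
      calc ((1 : ℕ) : ℝ) = 2 ^ T * (1 / 2) ^ T := by rw [← mul_pow]; norm_num
        _ ≤ 2 ^ T * W g := by gcongr
    · have := hW0 g
      simp only [Nat.cast_zero]
      positivity
  have hsum : ∑ g, W g ≤ (q : ℝ) ^ Fintype.card E * c ^ b := by
    let φ := Equiv.piEquivPiSubtypeProd (fun e => e ∈ Z) (fun _ : E => Fin q)
    rw [← Equiv.sum_comp φ.symm, Fintype.sum_prod_type_right]
    -- The labels outside `Z` are fixed first: they determine the set `B g`.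
    have key : ∀ y : {e // e ∉ Z} → Fin q,
        ∑ z : {e // e ∈ Z} → Fin q, W (φ.symm (z, y)) ≤ (q : ℝ) ^ #Z * c ^ b := by
      intro y
      have hφ : ∀ z z', B (φ.symm (z, y)) = B (φ.symm (z', y)) := fun z z' =>
        hB _ _ fun e he => by simp [φ, Equiv.piEquivPiSubtypeProd, he]
      set B₀ := B (φ.symm (fun _ => 0, y)) with hB₀
      have hBy : ∀ z, B (φ.symm (z, y)) = B₀ := fun z => hφ z _
      by_cases hb : b ≤ #B₀
      · have hWz : ∀ z : {e // e ∈ Z} → Fin q, W (φ.symm (z, y)) =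
            ∏ e : {e // e ∈ Z}, if (e : E) ∈ B₀ ∧ z e = 0 then (1 / 2 : ℝ) else 1 := by
          intro z
          simp only [W, hBy, hb, if_true]
          rw [← prod_filter, prod_const]
          congr 1
          symm
          refine card_bij (fun e _ => (e : E)) ?_ ?_ ?_
          · intro e he
            simp only [mem_filter, mem_univ, true_and] at he ⊢
            refine ⟨he.1, ?_⟩
            simpa [φ, Equiv.piEquivPiSubtypeProd] using he.2
          · intro a _ a' _ h
            exact Subtype.ext h
          · intro e he
            simp only [mem_filter] at he
            have heZ : e ∈ Z := hBZ _ he.1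
            refine ⟨⟨e, heZ⟩, ?_, rfl⟩
            simp only [mem_filter, mem_univ, true_and]
            refine ⟨he.1, ?_⟩
            simpa [φ, Equiv.piEquivPiSubtypeProd, heZ] using he.2
        simp only [hWz]
        have hfac := sum_prod_piFinset (ι := {e // e ∈ Z}) (univ : Finset (Fin q))
          (fun e x => if (e : E) ∈ B₀ ∧ x = 0 then (1 / 2 : ℝ) else 1)
        rw [Fintype.piFinset_univ] at hfac
        rw [hfac]
        have hone : ∀ e : {e // e ∈ Z},
            (∑ x : Fin q, if (e : E) ∈ B₀ ∧ x = 0 then (1 / 2 : ℝ) else 1) =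
              q * if (e : E) ∈ B₀ then c else 1 := by
          intro e
          by_cases he : (e : E) ∈ B₀
          · simp only [he, true_and, if_true]
            have : ∀ x : Fin q, (if x = 0 then (1 / 2 : ℝ) else 1) =
                1 - if x = 0 then 1 / 2 else 0 := fun x => by split_ifs <;> norm_num
            simp only [this, sum_sub_distrib, sum_ite_eq', mem_univ, if_true, sum_const, card_univ,
              Fintype.card_fin, nsmul_eq_mul, hc]
            field_simp
          · simp [he]
        simp only [hone]
        rw [prod_mul_distrib, prod_const, card_univ, Fintype.card_coe, ← prod_filter, prod_const]
        have hcard : #{e : {e // e ∈ Z} | (e : E) ∈ B₀} = #B₀ := by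
          refine card_bij (fun e _ => (e : E)) ?_ ?_ ?_
          · intro e he
            simpa using he
          · intro a _ a' _ h
            exact Subtype.ext h
          · intro e he
            exact ⟨⟨e, hBZ _ he⟩, by simpa using he, rfl⟩
        rw [hcard]
        gcongr ?_ * ?_
        exact pow_le_pow_of_le_one hc0 hc1 hb
      · have : ∀ z : {e // e ∈ Z} → Fin q, W (φ.symm (z, y)) = 0 := fun z => by
          simp [W, hBy, hb]
        simp only [this, sum_const_zero]
        positivity
    calc _ ≤ ∑ _y : {e // e ∉ Z} → Fin q, (q : ℝ) ^ #Z * c ^ b := sum_le_sum fun y _ => key y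
      _ = (q : ℝ) ^ Fintype.card E * c ^ b := by
        rw [sum_const, card_univ, Fintype.card_fun, Fintype.card_fin, nsmul_eq_mul,
          Fintype.card_subtype_compl, Fintype.card_coe, Nat.cast_pow, ← mul_assoc, ← pow_add,
          Nat.sub_add_cancel (card_le_univ Z)]
  calc _ ≤ 2 ^ T * ∑ g, W g := hlow
    _ ≤ 2 ^ T * ((q : ℝ) ^ Fintype.card E * c ^ b) := by gcongr
    _ = _ := by ring

end RandomLabellings

namespace SimpleGraph

/-! ### Triangle-free graphs with a separation property -/

variable {V : Type*}

/-- `x` and `y` are the ends of a walk of length two in `F`. The case `x = y` is allowed, and then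
says that `x` is not isolated. -/
def HasCommonNeighbor (F : SimpleGraph V) (x y : V) : Prop := ∃ w, F.Adj x w ∧ F.Adj w y

theorem HasCommonNeighbor.symm {F : SimpleGraph V} {x y : V} (h : F.HasCommonNeighbor x y) :
    F.HasCommonNeighbor y x :=
  let ⟨w, h1, h2⟩ := h
  ⟨w, h2.symm, h1.symm⟩

theorem HasCommonNeighbor.mono {F G : SimpleGraph V} (hFG : F ≤ G) {x y : V}
    (h : F.HasCommonNeighbor x y) : G.HasCommonNeighbor x y :=
  let ⟨w, h1, h2⟩ := h
  ⟨w, hFG h1, hFG h2⟩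

/-- Adjacent vertices have no common neighbour. This is `F.CliqueFree 3`, in the form that is
used below. -/
def IsTriangleFree (F : SimpleGraph V) : Prop := ∀ x y, F.Adj x y → ¬ F.HasCommonNeighbor x y

/-- Let `2 r` pairs `(u a, v a)` consist of `4 r` distinct vertices, and be divided into two groups
of `r` pairs. Then some pair of the first group and some pair of the second have adjacent
`v`-vertices, while their `u`-vertices have no common neighbour. -/
def Separates (F : SimpleGraph V) (r : ℕ) : Prop :=
  ∀ u v : Fin r ⊕ Fin r → V, Function.Injective (Sum.elim u v) →
    ∃ i j : Fin r, F.Adj (v (.inl i)) (v (.inr j)) ∧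
      ¬ F.HasCommonNeighbor (u (.inl i)) (u (.inr j))

/-- The graph of the pairs labelled `0`: for a uniformly random labelling `g`, the binomial random
graph with edge probability `1 / q`. -/
def zeroGraph {q : ℕ} [NeZero q] (g : Sym2 V → Fin q) : SimpleGraph V where
  Adj x y := x ≠ y ∧ g s(x, y) = 0
  symm := ⟨fun _ _ h => ⟨h.1.symm, by rw [Sym2.eq_swap]; exact h.2⟩⟩
  loopless := ⟨fun _ h => h.1 rfl⟩

/-- The graph `G` without the edges that lie in a triangle of `G`. -/
def removeTriangles (G : SimpleGraph V) : SimpleGraph V where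
  Adj x y := G.Adj x y ∧ ¬ G.HasCommonNeighbor x y
  symm := ⟨fun _ _ h => ⟨h.1.symm, fun h' => h.2 h'.symm⟩⟩
  loopless := ⟨fun _ h => h.1.ne rfl⟩

theorem removeTriangles_le (G : SimpleGraph V) : G.removeTriangles ≤ G := fun _ _ h => h.1

theorem isTriangleFree_removeTriangles (G : SimpleGraph V) : G.removeTriangles.IsTriangleFree :=
  fun _ _ h h' => h.2 (h'.mono G.removeTriangles_le)

open Finset

open scoped Classical in
/-- In a random graph it is very unlikely that, among the index pairs whose `u`-vertices have no
common neighbour, there are many but only few have adjacent `v`-vertices. As no vertex is both a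
`u a` and a `v a'`, a path of length two between `u`-vertices uses no edge between `v`-vertices, so
the two events are independent. -/
theorem card_filter_pairs_few_le {V : Type*} [Fintype V] {q : ℕ} [NeZero q] {r : ℕ}
    {u v : Fin r ⊕ Fin r → V} (huv : Function.Injective (Sum.elim u v)) (b T : ℕ) :
    (#{g : Sym2 V → Fin q |
        b ≤ #{p : Fin r × Fin r |
          ¬ (zeroGraph g).HasCommonNeighbor (u (.inl p.1)) (u (.inr p.2))} ∧
        #{p : Fin r × Fin r | (zeroGraph g).Adj (v (.inl p.1)) (v (.inr p.2)) ∧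
          ¬ (zeroGraph g).HasCommonNeighbor (u (.inl p.1)) (u (.inr p.2))} ≤ T} : ℝ) ≤
      (q : ℝ) ^ Fintype.card (Sym2 V) * (2 ^ T * (1 - 1 / (2 * q)) ^ b) := by
  have hv : Function.Injective v := fun a a' h => by
    simpa using @huv (.inr a) (.inr a') h
  have hne : ∀ a a', u a ≠ v a' := fun a a' h => by
    simpa using @huv (.inl a) (.inr a') h
  let e : Fin r × Fin r → Sym2 V := fun p => s(v (.inl p.1), v (.inr p.2))
  have he : Function.Injective e := by
    rintro ⟨i, j⟩ ⟨i', j'⟩ h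
    simp only [e, Sym2.eq_iff, hv.eq_iff] at h
    simpa using h
  let C : (Sym2 V → Fin q) → Finset (Fin r × Fin r) := fun g =>
    {p | ¬ (zeroGraph g).HasCommonNeighbor (u (.inl p.1)) (u (.inr p.2))}
  have hC : ∀ g g' : Sym2 V → Fin q, (∀ x ∉ univ.image e, g x = g' x) → C g = C g' := by
    intro g g' h
    -- A pair containing a vertex `u a` is not of the form `s(v i, v j)`.
    have hadj : ∀ a w, g s(u a, w) = g' s(u a, w) := by
      intro a w
      refine h _ ?_
      simp only [mem_image, mem_univ, true_and, not_exists]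
      intro p hp
      have : u a ∈ e p := by rw [hp]; exact Sym2.mem_mk_left _ _
      simp only [e, Sym2.mem_iff] at this
      exact this.elim (hne _ _) (hne _ _)
    have hadj' : ∀ a w, g s(w, u a) = g' s(w, u a) := fun a w => by
      rw [Sym2.eq_swap, hadj]
    ext p
    simp only [C, mem_filter, mem_univ, true_and]
    simp only [HasCommonNeighbor, zeroGraph, hadj, hadj']
  have := card_filter_few_zeros_le q (fun g => (C g).image e) (univ.image e)
    (fun g => image_subset_image (subset_univ _)) (fun g g' h => by rw [hC g g' h]) b T
  refine le_trans (le_of_eq ?_) this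
  congr 2
  ext g
  simp only [mem_filter, mem_univ, true_and, card_image_of_injective _ he, filter_image]
  have h2 : ({p : Fin r × Fin r | (zeroGraph g).Adj (v (.inl p.1)) (v (.inr p.2)) ∧
          ¬ (zeroGraph g).HasCommonNeighbor (u (.inl p.1)) (u (.inr p.2))} : Finset _) =
        {p ∈ C g | g (e p) = 0} := by
    ext p
    have : v (.inl p.1) ≠ v (.inr p.2) := fun h => by simpa using hv h
    simp only [C, mem_filter, mem_univ, true_and]
    rw [and_comm]
    exact and_congr_right fun _ => and_iff_right this
  rw [h2]


/-- First-moment bound: if each configuration `i` requires `k` given distinct pairs to be edges of the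
random graph, then the expected number of configurations is at most the number of all `i` divided
by `q ^ k`. -/
theorem sum_card_filter_zero_le {V ι : Type*} [Fintype V] [DecidableEq V] [Fintype ι] {q : ℕ}
    [NeZero q] (P : (Sym2 V → Fin q) → ι → Prop) [∀ g, DecidablePred (P g)]
    (T : ι → Finset (Sym2 V)) (k : ℕ)
    (hP : ∀ g i, P g i → #(T i) = k ∧ ∀ e ∈ T i, g e = 0) :
    ∑ g : Sym2 V → Fin q, (#{i | P g i} : ℝ) ≤
      Fintype.card ι * ((q : ℝ) ^ Fintype.card (Sym2 V) / (q : ℝ) ^ k) := by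
  have hswap : ∑ g : Sym2 V → Fin q, (#{i | P g i} : ℝ) =
      ∑ i : ι, (#{g : Sym2 V → Fin q | P g i} : ℝ) := by
    simp only [card_filter, Nat.cast_sum]
    exact sum_comm
  rw [hswap, ← nsmul_eq_mul, ← card_univ, ← sum_const]
  refine sum_le_sum fun i _ => ?_
  by_cases hk : #(T i) = k
  · rw [← hk, ← card_filter_forall_eq_zero q (T i)]
    exact_mod_cast card_le_card fun g hg => by
      simp only [mem_filter, mem_univ, true_and] at hg ⊢
      exact (hP g i hg).2
  · rw [filter_false_of_mem fun g _ h => hk (hP g i h).1]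
    simp only [card_empty, Nat.cast_zero]
    positivity

/-- Markov's inequality for counting measure. -/
theorem card_lt_mul_le_sum {Ω : Type*} [Fintype Ω] (X : Ω → ℕ) (a : ℕ) :
    (#{g | a < X g} : ℝ) * (a + 1) ≤ ∑ g, (X g : ℝ) := by
  calc (#{g | a < X g} : ℝ) * (a + 1) = ∑ g with a < X g, ((a : ℝ) + 1) := by
        rw [sum_const, nsmul_eq_mul]
    _ ≤ ∑ g with a < X g, (X g : ℝ) := sum_le_sum fun g hg => by
        exact_mod_cast (mem_filter.1 hg).2
    _ ≤ ∑ g, (X g : ℝ) := sum_le_sum_of_subset_of_nonneg (filter_subset _ _)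
        fun _ _ _ => Nat.cast_nonneg _

open scoped Classical in
/-- The deletion method. The bounds `h1`, `h2`, `h3` ensure that the random graph has, with positive
probability, at most `4 n` ordered triangles, at most `r ^ 2 / 2` ordered paths of length two, and,
for all choices of `u` and `v` at once, more than `4 n` suitable index pairs whenever at least half
of them have `u`-vertices without a common neighbour. The edges in triangles can then be removed. -/
theorem exists_isTriangleFree_separates_of_bounds {V : Type*} [Fintype V] [Nonempty V]
    (q r : ℕ) [NeZero q] (h1 : Fintype.card V ^ 2 ≤ q ^ 3)
    (h2 : 8 * Fintype.card V ^ 3 ≤ q ^ 2 * r ^ 2)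
    (h3 : (Fintype.card V : ℝ) ^ (4 * r) *
      (2 ^ (4 * Fintype.card V) * (1 - 1 / (2 * q)) ^ (r ^ 2 - r ^ 2 / 2)) < 1 / 2) :
    ∃ F : SimpleGraph V, F.IsTriangleFree ∧ F.Separates r := by
  set n := Fintype.card V with hn
  have hn0 : (0 : ℝ) < n := by exact_mod_cast Fintype.card_pos
  have hq : (0 : ℝ) < q := by exact_mod_cast Nat.pos_of_ne_zero (NeZero.ne q)
  set N : ℝ := (q : ℝ) ^ Fintype.card (Sym2 V) with hN
  have hN0 : 0 < N := by positivity
  let tri : (Sym2 V → Fin q) → V × V × V → Prop := fun g p =>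
    (zeroGraph g).Adj p.1 p.2.1 ∧ (zeroGraph g).Adj p.1 p.2.2 ∧ (zeroGraph g).Adj p.2.2 p.2.1
  let path : (Sym2 V → Fin q) → V × V × V → Prop := fun g p =>
    p.1 ≠ p.2.1 ∧ (zeroGraph g).Adj p.1 p.2.2 ∧ (zeroGraph g).Adj p.2.2 p.2.1
  have hcard3 : (Fintype.card (V × V × V) : ℝ) = (n : ℝ) ^ 3 := by
    simp only [Fintype.card_prod, ← hn]
    push_cast
    ring
  have htri : (#{g | 4 * n < #{p | tri g p}} : ℝ) ≤ N / 4 := by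
    have hs := (card_lt_mul_le_sum (fun g => #{p | tri g p}) (4 * n)).trans
      (sum_card_filter_zero_le tri
        (fun p => {s(p.1, p.2.1), s(p.1, p.2.2), s(p.2.2, p.2.1)}) 3 (by
          rintro g ⟨x, y, w⟩ ⟨hxy, hxw, hwy⟩
          refine ⟨?_, by simpa using ⟨hxy.2, hxw.2, hwy.2⟩⟩
          have a1 := hxy.1
          have a2 := hxw.1
          have a3 := hwy.1
          simp only at a1 a2 a3
          rw [card_eq_three]
          refine ⟨_, _, _, ?_, ?_, ?_, rfl⟩ <;> simp <;> tauto))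
    rw [hcard3] at hs
    have h1' : (n : ℝ) ^ 2 ≤ (q : ℝ) ^ 3 := by exact_mod_cast h1
    have h4 : (n : ℝ) ^ 3 * (N / (q : ℝ) ^ 3) ≤ n * N := by
      rw [← mul_div_assoc, div_le_iff₀ (by positivity)]
      have := mul_le_mul_of_nonneg_left h1' (mul_nonneg hn0.le hN0.le)
      nlinarith
    have h5 := hs.trans h4
    push_cast at h5
    set c : ℝ := (#{g | 4 * n < #{p | tri g p}} : ℝ) with hc
    have hc0 : 0 ≤ c := Nat.cast_nonneg _
    have h6 : c * 4 * n ≤ N * n := by nlinarith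
    have := le_of_mul_le_mul_right h6 hn0
    linarith
  have hpath : (#{g | r ^ 2 / 2 < #{p | path g p}} : ℝ) ≤ N / 4 := by
    have hs := (card_lt_mul_le_sum (fun g => #{p | path g p}) (r ^ 2 / 2)).trans
      (sum_card_filter_zero_le path
        (fun p => {s(p.1, p.2.2), s(p.2.2, p.2.1)}) 2 (by
          rintro g ⟨x, y, w⟩ ⟨hxy, hxw, hwy⟩
          refine ⟨?_, by simpa using ⟨hxw.2, hwy.2⟩⟩
          have a2 := hxw.1
          have a3 := hwy.1
          simp only at hxy a2 a3
          refine card_pair ?_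
          simp
          tauto))
    rw [hcard3] at hs
    have h2' : 8 * (n : ℝ) ^ 3 ≤ (q : ℝ) ^ 2 * (r : ℝ) ^ 2 := by exact_mod_cast h2
    have h4 : (n : ℝ) ^ 3 * (N / (q : ℝ) ^ 2) ≤ (r : ℝ) ^ 2 / 8 * N := by
      rw [← mul_div_assoc, div_le_iff₀ (by positivity)]
      have := mul_le_mul_of_nonneg_left h2' hN0.le
      nlinarith
    have h5 := hs.trans h4
    set c : ℝ := (#{g | r ^ 2 / 2 < #{p | path g p}} : ℝ) with hc
    have hc0 : 0 ≤ c := Nat.cast_nonneg _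
    have hr : (r : ℝ) ^ 2 / 2 ≤ ((r ^ 2 / 2 : ℕ) : ℝ) + 1 := by
      have : r ^ 2 ≤ 2 * (r ^ 2 / 2) + 2 := by omega
      have : (r : ℝ) ^ 2 ≤ 2 * ((r ^ 2 / 2 : ℕ) : ℝ) + 2 := by exact_mod_cast this
      linarith
    have hr0 : (0 : ℝ) < (r : ℝ) ^ 2 := by
      have : 0 < 8 * (n : ℝ) ^ 3 := by positivity
      by_contra h
      have h0 : (r : ℝ) ^ 2 = 0 := le_antisymm (not_lt.1 h) (by positivity)
      rw [h0, mul_zero] at h2'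
      linarith
    have h6 : c * 4 * (r : ℝ) ^ 2 ≤ N * (r : ℝ) ^ 2 := by
      have := mul_le_mul_of_nonneg_left hr hc0
      nlinarith
    have := le_of_mul_le_mul_right h6 hr0
    linarith
  let bad : (Fin r ⊕ Fin r → V) × (Fin r ⊕ Fin r → V) → (Sym2 V → Fin q) → Prop := fun w g =>
    r ^ 2 - r ^ 2 / 2 ≤ #{p : Fin r × Fin r |
          ¬ (zeroGraph g).HasCommonNeighbor (w.1 (.inl p.1)) (w.1 (.inr p.2))} ∧
        #{p : Fin r × Fin r | (zeroGraph g).Adj (w.2 (.inl p.1)) (w.2 (.inr p.2)) ∧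
          ¬ (zeroGraph g).HasCommonNeighbor (w.1 (.inl p.1)) (w.1 (.inr p.2))} ≤ 4 * n
  have hbad : (#{g | ∃ w, Function.Injective (Sum.elim w.1 w.2) ∧ bad w g} : ℝ) < N / 2 := by
    have hsub : ({g | ∃ w, Function.Injective (Sum.elim w.1 w.2) ∧ bad w g} : Finset _) ⊆
        ({w | Function.Injective (Sum.elim w.1 w.2)} : Finset _).biUnion
          fun w => {g | bad w g} := by
      intro g hg
      simpa using hg
    calc (#{g | ∃ w, Function.Injective (Sum.elim w.1 w.2) ∧ bad w g} : ℝ)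
        ≤ ∑ w : (Fin r ⊕ Fin r → V) × (Fin r ⊕ Fin r → V) with
            Function.Injective (Sum.elim w.1 w.2), (#{g | bad w g} : ℝ) := by
          exact_mod_cast (card_le_card hsub).trans card_biUnion_le
      _ ≤ ∑ w : (Fin r ⊕ Fin r → V) × (Fin r ⊕ Fin r → V) with
            Function.Injective (Sum.elim w.1 w.2),
            N * (2 ^ (4 * n) * (1 - 1 / (2 * q)) ^ (r ^ 2 - r ^ 2 / 2)) :=
          sum_le_sum fun w hw => card_filter_pairs_few_le (mem_filter.1 hw).2 _ _
      _ ≤ ∑ w : (Fin r ⊕ Fin r → V) × (Fin r ⊕ Fin r → V),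
            N * (2 ^ (4 * n) * (1 - 1 / (2 * q)) ^ (r ^ 2 - r ^ 2 / 2)) := by
          refine sum_le_sum_of_subset_of_nonneg (filter_subset _ _) fun _ _ _ => ?_
          have hq1 : (1 : ℝ) ≤ q := by exact_mod_cast NeZero.one_le
          have : 1 / (2 * (q : ℝ)) ≤ 1 := by
            rw [div_le_one (by positivity)]; linarith
          have : 0 ≤ 1 - 1 / (2 * (q : ℝ)) := by linarith
          positivity
      _ = N * ((n : ℝ) ^ (4 * r) *
            (2 ^ (4 * n) * (1 - 1 / (2 * q)) ^ (r ^ 2 - r ^ 2 / 2))) := by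
          rw [sum_const, card_univ, nsmul_eq_mul]
          simp only [Fintype.card_prod, Fintype.card_fun, Fintype.card_sum, Fintype.card_fin, ← hn]
          push_cast
          ring
      _ < N * (1 / 2) := by gcongr
      _ = N / 2 := by ring
  obtain ⟨g, hg1, hg2, hg3⟩ : ∃ g : Sym2 V → Fin q, #{p | tri g p} ≤ 4 * n ∧
      #{p | path g p} ≤ r ^ 2 / 2 ∧ ∀ w, Function.Injective (Sum.elim w.1 w.2) → ¬ bad w g := by
    by_contra! hcon
    have hcover : (univ : Finset (Sym2 V → Fin q)) ⊆
        ({g | 4 * n < #{p | tri g p}} : Finset _) ∪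
        (({g | r ^ 2 / 2 < #{p | path g p}} : Finset _) ∪
          ({g | ∃ w, Function.Injective (Sum.elim w.1 w.2) ∧ bad w g} : Finset _)) := by
      intro g _
      simp only [mem_union, mem_filter, mem_univ, true_and]
      by_cases a1 : #{p | tri g p} ≤ 4 * n
      · by_cases a2 : #{p | path g p} ≤ r ^ 2 / 2
        · exact .inr (.inr (hcon g a1 a2))
        · exact .inr (.inl (not_le.1 a2))
      · exact .inl (not_le.1 a1)
    have hc := (card_le_card hcover).trans ((card_union_le _ _).trans
      (Nat.add_le_add_left (card_union_le _ _) _))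
    rw [card_univ, Fintype.card_fun, Fintype.card_fin] at hc
    have hc' : N ≤ (#{g | 4 * n < #{p | tri g p}} : ℝ) +
        ((#{g | r ^ 2 / 2 < #{p | path g p}} : ℝ) +
          (#{g | ∃ w, Function.Injective (Sum.elim w.1 w.2) ∧ bad w g} : ℝ)) := by
      rw [hN]
      exact_mod_cast hc
    linarith
  refine ⟨(zeroGraph g).removeTriangles, isTriangleFree_removeTriangles _, fun u v huv => ?_⟩
  have hu : Function.Injective u := fun a a' h => by
    simpa using @huv (.inl a) (.inl a') h
  have hv : Function.Injective v := fun a a' h => by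
    simpa using @huv (.inr a) (.inr a') h
  -- If no index pair is suitable after the removal, then each one that was suitable before it has
  -- its `v`-vertices in a triangle, so there were at most `4 n` of them.
  by_contra! hcon
  have hinj : ∀ f : Fin r ⊕ Fin r → V, Function.Injective f → ∀ i j i' j' : Fin r,
      f (.inl i) = f (.inl i') → f (.inr j) = f (.inr j') → (i, j) = (i', j') := by
    intro f hf i j i' j' h h'
    simpa using And.intro (hf h) (hf h')
  refine hg3 (u, v) huv ⟨?_, ?_⟩
  · -- Index pairs whose `u`-vertices have a common neighbour inject into the paths of length two.
    have hle : #{p : Fin r × Fin r |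
        (zeroGraph g).HasCommonNeighbor (u (.inl p.1)) (u (.inr p.2))} ≤ r ^ 2 / 2 := by
      refine le_trans ?_ hg2
      have hch : ∀ p : Fin r × Fin r, ∃ w, (zeroGraph g).HasCommonNeighbor (u (.inl p.1))
          (u (.inr p.2)) → (zeroGraph g).Adj (u (.inl p.1)) w ∧
            (zeroGraph g).Adj w (u (.inr p.2)) := by
        intro p
        by_cases h : (zeroGraph g).HasCommonNeighbor (u (.inl p.1)) (u (.inr p.2))
        · obtain ⟨w, hw⟩ := h
          exact ⟨w, fun _ => hw⟩
        · exact ⟨u (.inl p.1), fun h' => absurd h' h⟩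
      choose w hw using hch
      refine card_le_card_of_injOn (fun p => (u (.inl p.1), u (.inr p.2), w p)) ?_ ?_
      · intro p hp
        simp only [coe_filter, mem_univ, true_and, Set.mem_ofPred_eq] at hp ⊢
        exact ⟨fun h => by simpa using hu h, hw p hp⟩
      · rintro ⟨i, j⟩ _ ⟨i', j'⟩ _ h
        simp only [Prod.mk.injEq] at h
        exact hinj u hu _ _ _ _ h.1 h.2.1
    have hadd := card_filter_add_card_filter_not (s := (univ : Finset (Fin r × Fin r)))
      (fun p => (zeroGraph g).HasCommonNeighbor (u (.inl p.1)) (u (.inr p.2)))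
    rw [card_univ, Fintype.card_prod, Fintype.card_fin, ← sq] at hadd
    simp only
    omega
  · refine le_trans ?_ hg1
    have hch : ∀ p : Fin r × Fin r, ∃ w, (zeroGraph g).HasCommonNeighbor (v (.inl p.1))
        (v (.inr p.2)) → (zeroGraph g).Adj (v (.inl p.1)) w ∧
          (zeroGraph g).Adj w (v (.inr p.2)) := by
      intro p
      by_cases h : (zeroGraph g).HasCommonNeighbor (v (.inl p.1)) (v (.inr p.2))
      · obtain ⟨w, hw⟩ := h
        exact ⟨w, fun _ => hw⟩
      · exact ⟨v (.inl p.1), fun h' => absurd h' h⟩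
    choose w hw using hch
    refine card_le_card_of_injOn (fun p => (v (.inl p.1), v (.inr p.2), w p)) ?_ ?_
    · intro p hp
      simp only [coe_filter, mem_univ, true_and, Set.mem_ofPred_eq] at hp ⊢
      refine ⟨hp.1, hw p ?_⟩
      by_contra hno
      exact hp.2 ((hcon p.1 p.2 ⟨hp.1, hno⟩).mono (removeTriangles_le _))
    · rintro ⟨i, j⟩ _ ⟨i', j'⟩ _ h
      simp only [Prod.mk.injEq] at h
      exact hinj v hv _ _ _ _ h.1 h.2.1


/-- The edge probability `1 / q` is about `n ^ (-2 / 3)`. It is far below `n ^ (-1 / 2)`, so that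
triangles and paths of length two are few; but it is far above `(log n) / n`, so that the expected
number `n ^ 2 / q` of suitable edges beats the `n ^ O(n)` choices of `u` and `v`. -/
theorem exists_isTriangleFree_separates (η : ℝ) (hη : 0 < η) :
    ∃ N : ℕ, ∀ n : ℕ, N ≤ n →
      ∃ F : SimpleGraph (Fin n), F.IsTriangleFree ∧ F.Separates ⌈η * n⌉₊ := by
  set δ : ℝ := η ^ 2 / (128 * (η + 1)) with hδ
  have hδ0 : 0 < δ := by positivity
  have hlog := (isLittleO_log_rpow_atTop (r := (1 / 3 : ℝ)) (by norm_num)).bound hδ0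
  have hbig := (tendsto_rpow_atTop (y := (1 / 3 : ℝ)) (by norm_num)).eventually_ge_atTop
    (160 / η ^ 2)
  have hev := tendsto_natCast_atTop_atTop.eventually
    ((hlog.and hbig).and (Filter.eventually_ge_atTop (1 : ℝ)))
  obtain ⟨N, hN⟩ := Filter.eventually_atTop.1 hev
  refine ⟨N, fun n hn => ?_⟩
  obtain ⟨⟨hl, hb⟩, hx1⟩ := hN n hn
  set x : ℝ := (n : ℝ) with hx
  set z : ℝ := x ^ (1 / 3 : ℝ) with hz
  have hx0 : 0 < x := by linarith
  have hz3 : z ^ 3 = x := by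
    rw [hz, ← Real.rpow_natCast, ← Real.rpow_mul hx0.le]
    norm_num
  have hz1 : 1 ≤ z := Real.one_le_rpow hx1 (by norm_num)
  have hz0 : 0 < z := by linarith
  have hlogx : Real.log x ≤ δ * z := by
    rw [Real.norm_of_nonneg (Real.log_nonneg hx1), Real.norm_of_nonneg hz0.le] at hl
    exact hl
  have hηz : 160 ≤ η ^ 2 * z := by
    rw [div_le_iff₀ (by positivity)] at hb
    linarith
  -- With `x = z ^ 3`, this is `q ≈ n ^ (2 / 3)`.
  set q : ℕ := ⌈z ^ 2⌉₊ with hq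
  have hqz : z ^ 2 ≤ q := Nat.le_ceil _
  have hq2 : (q : ℝ) ≤ 2 * z ^ 2 := by
    have := Nat.ceil_lt_add_one (a := z ^ 2) (by positivity)
    nlinarith
  have hqpos : 0 < q := by
    have : (0 : ℝ) < q := lt_of_lt_of_le (by positivity) hqz
    exact_mod_cast this
  set r : ℕ := ⌈η * x⌉₊ with hr
  have hrx : η * x ≤ r := Nat.le_ceil _
  have hrx' : (r : ℝ) ≤ η * x + 1 := (Nat.ceil_lt_add_one (by positivity)).le
  have : NeZero q := ⟨hqpos.ne'⟩
  have hn0 : 0 < n := by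
    rw [hx] at hx0
    exact_mod_cast hx0
  have : Nonempty (Fin n) := ⟨⟨0, hn0⟩⟩
  refine exists_isTriangleFree_separates_of_bounds q r ?_ ?_ ?_
  · rw [Fintype.card_fin]
    have : x ^ 2 ≤ (q : ℝ) ^ 3 := by
      calc x ^ 2 = (z ^ 2) ^ 3 := by rw [← hz3]; ring
        _ ≤ (q : ℝ) ^ 3 := by gcongr
    rw [hx] at this
    exact_mod_cast this
  · rw [Fintype.card_fin]
    have : 8 * x ^ 3 ≤ (q : ℝ) ^ 2 * (r : ℝ) ^ 2 := by
      calc 8 * x ^ 3 ≤ η ^ 2 * z * x ^ 3 := by gcongr; linarith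
        _ = (z ^ 2) ^ 2 * (η * x) ^ 2 := by rw [← hz3]; ring
        _ ≤ (q : ℝ) ^ 2 * (r : ℝ) ^ 2 := by gcongr
    rw [hx] at this
    exact_mod_cast this
  · rw [Fintype.card_fin, ← hx]
    set b : ℕ := r ^ 2 - r ^ 2 / 2 with hbdef
    have hq0 : (0 : ℝ) < q := by exact_mod_cast hqpos
    have hbr : (r : ℝ) ^ 2 / 2 ≤ b := by
      have : r ^ 2 ≤ 2 * b := by omega
      have : (r : ℝ) ^ 2 ≤ 2 * b := by exact_mod_cast this
      linarith
    have e1 : x ^ (4 * r) ≤ Real.exp (4 * (η * x + 1) * Real.log x) := by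
      rw [← Real.exp_log hx0, ← Real.exp_nat_mul, Real.exp_log hx0]
      refine Real.exp_le_exp.2 ?_
      have := Real.log_nonneg hx1
      push_cast
      gcongr
    have e2 : (2 : ℝ) ^ (4 * n) ≤ Real.exp (4 * x) := by
      have h2 : (2 : ℝ) ≤ Real.exp 1 := by
        have := Real.add_one_le_exp (1 : ℝ)
        linarith
      calc (2 : ℝ) ^ (4 * n) ≤ Real.exp 1 ^ (4 * n) := by gcongr
        _ = Real.exp (4 * x) := by
          rw [← Real.exp_nat_mul, hx]
          push_cast
          ring_nf
    have hc0 : 0 ≤ 1 - 1 / (2 * (q : ℝ)) := by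
      have hq1 : (1 : ℝ) ≤ q := by exact_mod_cast hqpos
      have : 1 / (2 * (q : ℝ)) ≤ 1 := by
        rw [div_le_one (by positivity)]; linarith
      linarith
    have e3 : (1 - 1 / (2 * (q : ℝ))) ^ b ≤ Real.exp (-(η ^ 2 * (x * z) / 8)) := by
      calc (1 - 1 / (2 * (q : ℝ))) ^ b ≤ Real.exp (-(1 / (2 * (q : ℝ)))) ^ b := by
            gcongr
            exact Real.one_sub_le_exp_neg _
        _ = Real.exp (-(b / (2 * q))) := by
            rw [← Real.exp_nat_mul]
            congr 1
            ring
        _ ≤ Real.exp (-(η ^ 2 * (x * z) / 8)) := by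
            refine Real.exp_le_exp.2 (neg_le_neg ?_)
            rw [le_div_iff₀ (by positivity)]
            calc η ^ 2 * (x * z) / 8 * (2 * q) ≤ η ^ 2 * (x * z) / 8 * (2 * (2 * z ^ 2)) := by
                  gcongr
              _ = (η * x) ^ 2 / 2 := by
                  have : z * z ^ 2 = x := by rw [← hz3]; ring
                  linear_combination (η ^ 2 * x / 2) * this
              _ ≤ (r : ℝ) ^ 2 / 2 := by gcongr
              _ ≤ b := hbr
    have hmain : 4 * (η * x + 1) * Real.log x + (4 * x + -(η ^ 2 * (x * z) / 8)) ≤ -1 := by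
      have a1 : 4 * (η * x + 1) * Real.log x ≤ 4 * ((η + 1) * x) * (δ * z) := by
        gcongr
        nlinarith
      have a2 : 4 * ((η + 1) * x) * (δ * z) = η ^ 2 * (x * z) / 32 := by
        rw [hδ]
        field_simp
        norm_num
      have a3 : 160 * x ≤ η ^ 2 * (x * z) := by nlinarith
      linarith
    calc x ^ (4 * r) * (2 ^ (4 * n) * (1 - 1 / (2 * (q : ℝ))) ^ b)
        ≤ Real.exp (4 * (η * x + 1) * Real.log x) *
          (Real.exp (4 * x) * Real.exp (-(η ^ 2 * (x * z) / 8))) := by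
          refine mul_le_mul e1 (mul_le_mul e2 e3 (pow_nonneg hc0 _) (Real.exp_pos _).le)
            (mul_nonneg (by positivity) (pow_nonneg hc0 _)) (Real.exp_pos _).le
      _ = Real.exp (4 * (η * x + 1) * Real.log x + (4 * x + -(η ^ 2 * (x * z) / 8))) := by
          rw [Real.exp_add, Real.exp_add]
      _ ≤ Real.exp (-1) := Real.exp_le_exp.2 hmain
      _ < 1 / 2 := by
          have := Real.exp_neg_one_lt_d9
          linarith

theorem Separates.exists_of_le_card {V ι : Type*} {F : SimpleGraph V} {r : ℕ}
    (hF : F.Separates r) {u v : ι → V} {A : Finset ι} (hu : Set.InjOn u A) (hv : Set.InjOn v A)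
    (huv : ∀ i ∈ A, ∀ j ∈ A, u i ≠ v j) {P P' : Finset ι} (hP : P ⊆ A) (hP' : P' ⊆ A)
    (hPP' : Disjoint P P') (hr : r ≤ #P) (hr' : r ≤ #P') :
    ∃ i ∈ P, ∃ j ∈ P', F.Adj (v i) (v j) ∧ ¬ F.HasCommonNeighbor (u i) (u j) := by
  obtain ⟨e⟩ : Nonempty (Fin r ↪ P) := Function.Embedding.nonempty_of_card_le (by simpa)
  obtain ⟨e'⟩ : Nonempty (Fin r ↪ P') := Function.Embedding.nonempty_of_card_le (by simpa)
  let f : Fin r ⊕ Fin r → ι := Sum.elim (fun i => (e i : ι)) (fun i => (e' i : ι))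
  have hf : Function.Injective f := by
    refine Function.Injective.sumElim (Subtype.val_injective.comp e.injective)
      (Subtype.val_injective.comp e'.injective) fun i j h => ?_
    exact Finset.disjoint_left.1 hPP' (e i).2 (by rw [h]; exact (e' j).2)
  have hfA : ∀ a, f a ∈ A := by
    rintro (i | i)
    · exact hP (e i).2
    · exact hP' (e' i).2
  obtain ⟨i, j, h1, h2⟩ := hF (u ∘ f) (v ∘ f) (Function.Injective.sumElim
    (fun a a' h => hf (hu (hfA a) (hfA a') h)) (fun a a' h => hf (hv (hfA a) (hfA a') h))
    fun a a' => huv _ (hfA a) _ (hfA a'))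
  exact ⟨e i, (e i).2, e' j, (e' j).2, h1, h2⟩

/-- The independence number of a graph that separates is small: list the pairs inside `X`. -/
theorem Separates.exists_adj_of_le_card {V : Type*} {F : SimpleGraph V} {r : ℕ}
    (hF : F.Separates r) {X : Finset V} (hX : 4 * r ≤ #X) : ∃ x ∈ X, ∃ y ∈ X, F.Adj x y := by
  obtain ⟨e⟩ : Nonempty ((Fin r ⊕ Fin r) ⊕ (Fin r ⊕ Fin r) ↪ X) :=
    Function.Embedding.nonempty_of_card_le (by simp; omega)
  obtain ⟨i, j, h, -⟩ := hF (fun a => e (.inl a)) (fun a => e (.inr a)) (by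
    convert Subtype.val_injective.comp e.injective using 1
    funext a
    cases a <;> rfl)
  exact ⟨_, (e _).2, _, (e _).2, h⟩

/-! ### The product of two graphs along a colouring -/

/-- The graph on `V` built from a graph `F` on `V` and a graph `D` on a set `K` of colours, for a
colouring `τ : V → K` that need not be proper: `x` and `y` are joined if they are adjacent in one of
the two graphs and have no common neighbour in the other. -/
def colouredProduct {V K : Type*} (F : SimpleGraph V) (D : SimpleGraph K) (τ : V → K) :
    SimpleGraph V where
  Adj x y := (D.Adj (τ x) (τ y) ∧ ¬ F.HasCommonNeighbor x y) ∨
    (F.Adj x y ∧ ¬ D.HasCommonNeighbor (τ x) (τ y))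
  symm := ⟨fun _ _ h => h.imp (fun h => ⟨h.1.symm, fun h' => h.2 h'.symm⟩)
    (fun h => ⟨h.1.symm, fun h' => h.2 h'.symm⟩)⟩
  loopless := ⟨fun _ h => h.elim (fun h => h.1.ne rfl) (fun h => h.1.ne rfl)⟩

theorem isTriangleFree_colouredProduct {V K : Type*} {F : SimpleGraph V} {D : SimpleGraph K}
    (hF : F.IsTriangleFree) (hD : D.IsTriangleFree) (τ : V → K) :
    (colouredProduct F D τ).IsTriangleFree := by
  -- Two of the three edges come from the same clause; their path rules out the other clause for
  -- the third edge, which then closes a triangle in `D` or in `F`.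
  rintro x y h ⟨w, h1, h2⟩
  have hF' : ∀ {a b c}, F.Adj a b → F.Adj b c → F.Adj a c → False :=
    fun h1 h2 h3 => hF _ _ h3 ⟨_, h1, h2⟩
  have hD' : ∀ {a b c}, D.Adj a b → D.Adj b c → D.Adj a c → False :=
    fun h1 h2 h3 => hD _ _ h3 ⟨_, h1, h2⟩
  rcases h with h | h <;> rcases h1 with h1 | h1 <;> rcases h2 with h2 | h2
  · exact hD' h1.1 h2.1 h.1
  · exact h2.2 ⟨_, h1.1.symm, h.1⟩
  · exact h1.2 ⟨_, h.1, h2.1.symm⟩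
  · exact h.2 ⟨_, h1.1, h2.1⟩
  · exact h.2 ⟨_, h1.1, h2.1⟩
  · exact h1.2 ⟨_, h.1, h2.1.symm⟩
  · exact h2.2 ⟨_, h1.1.symm, h.1⟩
  · exact hF' h1.1 h2.1 h.1

theorem IsTriangleFree.indepNum_compl_le {V : Type*} [Fintype V] {H : SimpleGraph V}
    (hH : H.IsTriangleFree) : Hᶜ.indepNum ≤ 2 := by
  obtain ⟨S, hS⟩ := Hᶜ.exists_isNIndepSet_indepNum
  rw [isNIndepSet_iff, isIndepSet_compl] at hS
  by_contra! hlt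
  rw [← hS.2, two_lt_card] at hlt
  obtain ⟨a, ha, b, hb, c, hc, hab, hac, hbc⟩ := hlt
  exact hH a b (hS.1 ha hb hab) ⟨c, hS.1 ha hc hac, hS.1 hc hb hbc.symm⟩

open scoped Classical in
/-- Count the pairs `(u i, v i)` by the colours `(a, b)` of their vertices. Say that `(a, b)` is heavy
if at least `r` pairs have these colours. As `F` separates, two heavy classes `(a, b)`, `(a', b')`
cannot have `a, a'` adjacent and `b, b'` without common neighbour in `D`. As `D` separates, the
heavy classes are therefore covered by at most `8 r'` colours. -/
theorem card_le_of_isOddConnectedPairing_compl_colouredProduct {V K : Type*} [Fintype V]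
    [Fintype K] {F : SimpleGraph V} {D : SimpleGraph K} {τ : V → K} {r r' m : ℕ}
    (hFs : F.Separates r) (hDt : D.IsTriangleFree) (hDs : D.Separates r')
    (hτ : ∀ a, #{x | τ x = a} ≤ m) {s : ℕ} {u v : Fin s → V}
    (h : (colouredProduct F D τ)ᶜ.IsOddConnectedPairing u v) :
    s ≤ 8 * r' * m + Fintype.card K ^ 2 * r := by
  have hu : Function.Injective u := fun i j hij => by simpa using @h.distinct (.inl i) (.inl j) hij
  have hv : Function.Injective v := fun i j hij => by simpa using @h.distinct (.inr i) (.inr j) hij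
  have huv : ∀ i j, u i ≠ v j := fun i j hij => by simpa using @h.distinct (.inl i) (.inr j) hij
  let C : K × K → Finset (Fin s) := fun p => {i | (τ (u i), τ (v i)) = p}
  let S : Finset (K × K) := {p | r ≤ #(C p)}
  have hS : ∀ p ∈ S, ∀ p' ∈ S, D.Adj p.1 p'.1 → D.HasCommonNeighbor p.2 p'.2 := by
    intro p hp p' hp' hD
    by_contra hno
    obtain ⟨i, hi, j, hj, hF, hFno⟩ := hFs.exists_of_le_card (A := univ) hu.injOn hv.injOn
      (fun i _ j _ => huv i j) (subset_univ (C p)) (subset_univ (C p'))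
      (Finset.disjoint_left.2 fun i hi hi' => by
        simp only [C, mem_filter, mem_univ, true_and] at hi hi'
        exact hD.ne (by rw [← hi, ← hi'])) (mem_filter.1 hp).2 (mem_filter.1 hp').2
    simp only [C, mem_filter, mem_univ, true_and, Prod.ext_iff] at hi hj
    have hij : i ≠ j := fun hij => hF.ne (by rw [hij])
    rcases h.connected i j hij with hadj | hadj
    · exact ((compl_adj _ _ _).1 hadj).2 (.inl ⟨by rw [hi.1, hj.1]; exact hD, hFno⟩)
    · exact ((compl_adj _ _ _).1 hadj).2 (.inr ⟨hF, by rw [hi.2, hj.2]; exact hno⟩)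
  -- The heavy classes on the diagonal.
  let X₀ : Finset K := {a | (a, a) ∈ S}
  have hX₀ : #X₀ < 4 * r' := by
    by_contra! hcon
    obtain ⟨a, ha, b, hb, hab⟩ := hDs.exists_adj_of_le_card hcon
    exact hDt a b hab (hS _ (mem_filter.1 ha).2 _ (mem_filter.1 hb).2 hab)
  -- A largest family of heavy classes whose coordinates are all distinct.
  let Indep : Finset (K × K) → Prop := fun M =>
    Set.InjOn Prod.fst (M : Set (K × K)) ∧ Set.InjOn Prod.snd (M : Set (K × K)) ∧
      ∀ p ∈ M, ∀ p' ∈ M, p.1 ≠ p'.2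
  obtain ⟨M, hM, hMmax⟩ := exists_max_image ({M ∈ S.powerset | Indep M} : Finset _) card
    ⟨∅, by simp [Indep]⟩
  simp only [mem_filter, mem_powerset, and_imp] at hM hMmax
  obtain ⟨hMS, hM1, hM2, hM3⟩ := hM
  have hMcard : #M < 2 * r' := by
    by_contra! hcon
    obtain ⟨P, hPM, hP⟩ := exists_subset_card_eq (show r' ≤ #M by omega)
    have hP' : r' ≤ #(M \ P) := by
      rw [card_sdiff_of_subset hPM]
      omega
    obtain ⟨p, hp, p', hp', hD, hno⟩ := hDs.exists_of_le_card (A := M) (u := Prod.snd)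
      (v := Prod.fst) hM2 hM1 (fun i hi j hj => (hM3 j hj i hi).symm) hPM sdiff_subset
      disjoint_sdiff hP.ge hP'
    exact hno (hS p (hMS (hPM hp)) p' (hMS (sdiff_subset hp')) hD)
  let X : Finset K := X₀ ∪ (M.image Prod.fst ∪ M.image Prod.snd)
  have hXcard : #X ≤ 8 * r' := by
    have a1 : #X ≤ #X₀ + #(M.image Prod.fst ∪ M.image Prod.snd) := card_union_le _ _
    have a2 := card_union_le (M.image Prod.fst) (M.image Prod.snd)
    have a3 : #(M.image Prod.fst) ≤ #M := card_image_le
    have a4 : #(M.image Prod.snd) ≤ #M := card_image_le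
    omega
  -- By maximality of `M`, the colours in `X` meet every heavy class.
  have hcover : ∀ p ∈ S, p.1 ∈ X ∨ p.2 ∈ X := by
    rintro ⟨a, b⟩ hp
    by_contra! hcon
    simp only [X, mem_union, not_or] at hcon
    obtain ⟨⟨ha0, ha1, ha2⟩, hb0, hb1, hb2⟩ := hcon
    have hab : a ≠ b := fun hab => ha0 (by
      simp only [X₀, mem_filter, mem_univ, true_and]
      rw [← hab] at hp
      exact hp)
    have hpM : (a, b) ∉ M := fun h => ha1 (mem_image_of_mem Prod.fst h)
    have f1 : ∀ p ∈ M, p.1 ≠ a := fun p h e => ha1 (e ▸ mem_image_of_mem Prod.fst h)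
    have f2 : ∀ p ∈ M, p.2 ≠ a := fun p h e => ha2 (e ▸ mem_image_of_mem Prod.snd h)
    have f3 : ∀ p ∈ M, p.1 ≠ b := fun p h e => hb1 (e ▸ mem_image_of_mem Prod.fst h)
    have f4 : ∀ p ∈ M, p.2 ≠ b := fun p h e => hb2 (e ▸ mem_image_of_mem Prod.snd h)
    have := hMmax (insert (a, b) M) (insert_subset hp hMS) (by
      refine ⟨?_, ?_, ?_⟩
      · rw [coe_insert, Set.injOn_insert (by exact_mod_cast hpM)]
        exact ⟨hM1, by rintro ⟨p, h, e⟩; exact f1 p h e⟩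
      · rw [coe_insert, Set.injOn_insert (by exact_mod_cast hpM)]
        exact ⟨hM2, by rintro ⟨p, h, e⟩; exact f4 p h e⟩
      · intro p h p' h'
        rcases mem_insert.1 h with rfl | h <;> rcases mem_insert.1 h' with rfl | h'
        · exact hab
        · exact (f2 p' h').symm
        · exact f3 p h
        · exact hM3 p h p' h')
    rw [card_insert_of_notMem hpM] at this
    omega
  -- The pairs with a colour in `X` are as few as the vertices with such a colour, because the
  -- vertices of a pairing are distinct; the other pairs lie in light classes.
  let I : Finset (Fin s) := {i | τ (u i) ∈ X ∨ τ (v i) ∈ X}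
  have hI : #I ≤ 8 * r' * m := by
    have h1 : #I ≤ #{x : V | τ x ∈ X} := by
      refine card_le_card_of_injOn (fun i => if τ (u i) ∈ X then u i else v i) ?_ ?_
      · intro i hi
        simp only [I, coe_filter, mem_univ, true_and, Set.mem_ofPred_eq] at hi ⊢
        split_ifs with hi'
        · exact hi'
        · exact hi.resolve_left hi'
      · intro i _ j _ hij
        simp only at hij
        split_ifs at hij
        · exact hu hij
        · exact absurd hij (huv i j)
        · exact absurd hij.symm (huv j i)
        · exact hv hij
    have h2 : ({x : V | τ x ∈ X} : Finset V) = X.biUnion fun a => {x | τ x = a} := by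
      ext x
      simp
    calc #I ≤ #(X.biUnion fun a => ({x | τ x = a} : Finset V)) := h2 ▸ h1
      _ ≤ #X * m := card_biUnion_le_card_mul _ _ _ fun a _ => hτ a
      _ ≤ 8 * r' * m := Nat.mul_le_mul_right _ hXcard
  have hL : #(Sᶜ.biUnion C) ≤ Fintype.card K ^ 2 * r := by
    calc #(Sᶜ.biUnion C) ≤ #Sᶜ * r := card_biUnion_le_card_mul _ _ _ fun p hp => by
          simp only [S, mem_compl, mem_filter, mem_univ, true_and, not_le] at hp
          exact hp.le
      _ ≤ Fintype.card K ^ 2 * r := by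
          refine Nat.mul_le_mul_right _ ((card_le_univ _).trans_eq ?_)
          rw [Fintype.card_prod, sq]
  have huniv : (univ : Finset (Fin s)) ⊆ I ∪ Sᶜ.biUnion C := by
    intro i _
    by_cases hi : (τ (u i), τ (v i)) ∈ S
    · exact mem_union_left _ (by simpa [I] using hcover _ hi)
    · exact mem_union_right _ (mem_biUnion.2 ⟨_, mem_compl.2 hi, by simp [C]⟩)
  have := (card_le_card huniv).trans (card_union_le _ _)
  rw [card_univ, Fintype.card_fin] at this
  omega

theorem card_filter_mod_eq_le (n k : ℕ) (hk : 0 < k) (a : Fin k) :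
    #{x : Fin n | (⟨x % k, Nat.mod_lt _ hk⟩ : Fin k) = a} ≤ n / k + 1 := by
  rw [← card_range (n / k + 1)]
  refine card_le_card_of_injOn (fun x => (x : ℕ) / k) ?_ ?_
  · intro x _
    simpa [Nat.lt_succ_iff] using Nat.div_le_div_right x.2.le
  · intro x hx y hy hxy
    simp only [coe_filter, mem_univ, true_and, Set.mem_ofPred_eq] at hx hy hxy
    have h := congrArg Fin.val (hx.trans hy.symm)
    simp only at h
    ext
    rw [← Nat.div_add_mod (x : ℕ) k, ← Nat.div_add_mod (y : ℕ) k, hxy, h]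

end SimpleGraph

/-! ### Graphs without linear odd connected pairings -/

theorem theorem3p1 (ε : ℝ) (hε : 0 < ε) :
    ∃ N : ℕ, ∀ n : ℕ, N ≤ n →
      ∃ G : SimpleGraph (Fin n), G.indepNum ≤ 2 ∧
        ∀ s : ℕ, ε * (n : ℝ) ≤ (s : ℝ) → ¬ G.HasOddConnectedPairing s := by
  classical
  obtain ⟨N₁, hN₁⟩ := SimpleGraph.exists_isTriangleFree_separates (ε / 64) (by positivity)
  set k : ℕ := max N₁ ⌈64 / ε⌉₊ with hk
  have hkε : 64 ≤ ε * k := by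
    have h1 : (64 / ε : ℝ) ≤ k := (Nat.le_ceil _).trans (by exact_mod_cast le_max_right _ _)
    rw [div_le_iff₀ hε] at h1
    linarith
  have hk0 : (0 : ℝ) < k := by
    by_contra! hcon
    have : ε * k ≤ 0 := mul_nonpos_of_nonneg_of_nonpos hε.le hcon
    linarith
  have hk0' : 0 < k := by exact_mod_cast hk0
  obtain ⟨D, hDt, hDs⟩ := hN₁ k (le_max_left _ _)
  obtain ⟨N₂, hN₂⟩ := SimpleGraph.exists_isTriangleFree_separates (ε / (8 * k ^ 2)) (by positivity)
  refine ⟨max N₂ (max k ⌈8 * k ^ 2 / ε⌉₊), fun n hn => ?_⟩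
  simp only [max_le_iff] at hn
  obtain ⟨hn2, hnk, hnε⟩ := hn
  obtain ⟨F, hFt, hFs⟩ := hN₂ n hn2
  let τ : Fin n → Fin k := fun x => ⟨x % k, Nat.mod_lt _ hk0'⟩
  refine ⟨(SimpleGraph.colouredProduct F D τ)ᶜ,
    (SimpleGraph.isTriangleFree_colouredProduct hFt hDt τ).indepNum_compl_le, ?_⟩
  rintro s hs ⟨u, v, huv⟩
  have hle := SimpleGraph.card_le_of_isOddConnectedPairing_compl_colouredProduct hFs hDt hDs
    (fun a => by convert SimpleGraph.card_filter_mod_eq_le n k hk0' a) huv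
  rw [Fintype.card_fin] at hle
  set r' : ℕ := ⌈ε / 64 * (k : ℝ)⌉₊ with hr'
  set r : ℕ := ⌈ε / (8 * (k : ℝ) ^ 2) * (n : ℝ)⌉₊ with hr
  have hr'le : (r' : ℝ) ≤ ε / 64 * k + 1 := (Nat.ceil_lt_add_one (by positivity)).le
  have hrle : (r : ℝ) ≤ ε / (8 * (k : ℝ) ^ 2) * n + 1 := (Nat.ceil_lt_add_one (by positivity)).le
  have hkn : (k : ℝ) ≤ n := by exact_mod_cast hnk
  have hn0 : (0 : ℝ) < n := by linarith
  have hnε' : 8 * (k : ℝ) ^ 2 ≤ ε * n := by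
    have h1 : (8 * k ^ 2 / ε : ℝ) ≤ n := (Nat.le_ceil _).trans (by exact_mod_cast hnε)
    rw [div_le_iff₀ hε] at h1
    linarith
  have hle' : (s : ℝ) ≤ 8 * r' * ((n / k : ℕ) + 1) + k ^ 2 * r := by exact_mod_cast hle
  have hdiv : ((n / k : ℕ) : ℝ) + 1 ≤ 2 * (n / k) := by
    have h1 : ((n / k : ℕ) : ℝ) ≤ n / k := Nat.cast_div_le
    have h2 : (1 : ℝ) ≤ n / k := by rwa [one_le_div hk0]
    linarith
  have b1 : 8 * (r' : ℝ) * ((n / k : ℕ) + 1) ≤ ε * n / 2 := by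
    calc 8 * (r' : ℝ) * ((n / k : ℕ) + 1) ≤ 8 * (ε / 64 * k + ε * k / 64) * (2 * (n / k)) := by
          gcongr
          linarith
      _ = ε * n / 2 := by
          field_simp
          norm_num
  have b2 : (k : ℝ) ^ 2 * r ≤ ε * n / 4 := by
    calc (k : ℝ) ^ 2 * r ≤ k ^ 2 * (ε / (8 * (k : ℝ) ^ 2) * n + 1) := by gcongr
      _ = ε * n / 8 + k ^ 2 := by field_simp
      _ ≤ ε * n / 4 := by linarith
  have : 0 < ε * n := by positivity
  linarith
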